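/- There exists a compactly supported Borel probability measure $\nu$ on $\mathbb{R}$ with mean $0$ and variance $1$ such that the following two assertions hold. (1) $V(m)=1+3m+2m^2+m^3$ is the variance function of the Cauchy–Stieltjes kernel (CSK) family generated by $\nu$. That is, let $A=\min\{0,\inf\operatorname{supp}\nu\}$, $B=\max\{0,\sup\operatorname{supp}\nu\}$, $\theta_-=1/A$ (with $\theta_-=-\infty$ if $A=0$), $\theta_+=1/B$ (with $\theta_+=+\infty$ if $B=0$), and for $\theta\in(\theta_-,\theta_+)$ let $$P_\theta(dx)=\frac{1}{M(\theta)(1-\theta x)}\,\nu(dx),\qquad M(\theta)=\int\frac{1}{1-\theta x}\,\nu(dx).$$ For $m$ in the domain of means $\{\int x\,P_\theta(dx):\theta\in(\theta_-,\theta_+)\}$ let $Q_m$ be the member of the family $(P_\theta)$ with mean $m$. Then $\int (x-m)^2\,Q_m(dx)=1+3m+2m^2+m^3$ for every $m$ in the domain of means. (2) The boolean cumulants $r_n=r_n(\nu)$ of $\nu$, defined by $r_0=0$ and the Laurent expansion at infinity $$z-\frac{1}{G_\nu(z)}=\sum_{n\ge 1} r_n\,z^{-(n-1)},\qquad G_\nu(z)=\int\frac{1}{z-x}\,\nu(dx),$$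 are $r_1=0$ and the Fuss–Catalan numbers $$r_{n+1}=\frac{1}{3n+1}\binom{3n+1}{n}\qquad\text{for all } n\ge 1 .$$ -/

import Mathlib

noncomputable section

open MeasureTheory

namespace CauchyStieltjes

/-- `B(ν) = max {0, sup supp ν}`. -/
def upperEdge (ν : Measure ℝ) : ℝ := max 0 (sSup ν.support)

/-- `A(ν) = min {0, inf supp ν}`. -/
def lowerEdge (ν : Measure ℝ) : ℝ := min 0 (sInf ν.support)

/-- The parameter interval `(θ₋, θ₊)` of the two-sided Cauchy–Stieltjes kernel (CSK) family of a
compactly supported `ν`. Here `θ₊ = 1 / B(ν)`, read as `+∞` if `B(ν) = 0`, and `θ₋ = 1 / A(ν)`,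
read as `-∞` if `A(ν) = 0`. As `A(ν) ≤ 0 ≤ B(ν)`, the condition `θ < θ₊` is `θ * B(ν) < 1` and
the condition `θ₋ < θ` is `θ * A(ν) < 1`. -/
def paramSet (ν : Measure ℝ) : Set ℝ := {θ | θ * lowerEdge ν < 1 ∧ θ * upperEdge ν < 1}

/-- The normalizing constant `M_ν(θ) = ∫ 1 / (1 - θ x) ν(dx)`. -/
def M (ν : Measure ℝ) (θ : ℝ) : ℝ := ∫ x, 1 / (1 - θ * x) ∂ν

/-- The member `P_{(θ,ν)}(dx) = ν(dx) / (M_ν(θ) (1 - θ x))` of the CSK family generated by `ν`.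
For `θ = 0` and `ν` a probability measure it is `ν` itself. -/
def P (ν : Measure ℝ) (θ : ℝ) : Measure ℝ :=
  ν.withDensity fun x => ENNReal.ofReal (1 / (M ν θ * (1 - θ * x)))

/-- The mean `k_ν(θ) = ∫ x P_{(θ,ν)}(dx)`. -/
def meanMap (ν : Measure ℝ) (θ : ℝ) : ℝ := ∫ x, x ∂(P ν θ)

/-- The two-sided domain of means: the set of means of the members of the CSK family. -/
def meanDomain (ν : Measure ℝ) : Set ℝ := meanMap ν '' paramSet ν

/-- `ψ_ν`, the inverse of `k_ν : (θ₋, θ₊) → meanDomain ν`. -/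
def psi (ν : Measure ℝ) : ℝ → ℝ := Function.invFunOn (meanMap ν) (paramSet ν)

/-- The parametrization by the mean: `Q_{(m,ν)}` is the member of the CSK family with mean `m`,
for `m` in the domain of means. -/
def Q (ν : Measure ℝ) (m : ℝ) : Measure ℝ := P ν (psi ν m)

/-- The variance function `V_ν(m) = ∫ (x - m)² Q_{(m,ν)}(dx)`, meaningful for `m` in the domain
of means. -/
def varianceFunction (ν : Measure ℝ) (m : ℝ) : ℝ := ∫ x, (x - m) ^ 2 ∂(Q ν m)

/-- The Cauchy transform `G_ν(z) = ∫ 1 / (z - x) ν(dx)`. -/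
def cauchyTransform (ν : Measure ℝ) (z : ℂ) : ℂ := ∫ x, 1 / (z - (x : ℂ)) ∂ν

/-- The K-transform (self energy) `K_ν(z) = z - 1 / G_ν(z)`. -/
def KTransform (ν : Measure ℝ) (z : ℂ) : ℂ := z - 1 / cauchyTransform ν z

/-- `r 0, r 1, r 2, …` are the boolean cumulants of the compactly supported measure `ν`: `r 0 = 0`
and `K_ν(z) = ∑_{n ≥ 1} r_n / z ^ (n - 1)` in a neighbourhood of infinity (the sum is indexed by
`n - 1` below). Laurent coefficients being unique, at most one sequence has this property. -/
def IsBooleanCumulantSeq (ν : Measure ℝ) (r : ℕ → ℝ) : Prop :=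
  r 0 = 0 ∧ ∀ᶠ z : ℂ in Bornology.cobounded ℂ,
    HasSum (fun n : ℕ => (r (n + 1) : ℂ) / z ^ n) (KTransform ν z)

end CauchyStieltjes

end

/-! Let `B` be the generating function of the Fuss–Catalan numbers, so `B = 1 + X * B ^ 3`. The
prescribed boolean cumulants say `K(z) = B(1/z) - 1`, that is `M(θ) = 1 / (1 - θ (B(θ) - 1))` near
0. Since `θ m M = M - 1` for the mean `m` of `P_θ`, this gives `m = B(θ) - 1`, hence `m = θ (1 + m)
^ 3`. As `ν` is centred, the second moment of `P_θ` is `m / θ = (1 + m) ^ 3`, and the variance is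
`(1 + m) ^ 3 - m ^ 2 = 1 + 3m + 2m² + m³`.

The power series argument covers only small `θ`. Eliminating `B` leaves a polynomial relation
between `θ` and `M`, which extends to the whole parameter interval by the identity theorem
(`IsFussCatalanBoolean.complexM_eq`).

Existence of `ν`: the shifted Fuss–Catalan numbers are the moments of a probability measure `ρ` on
`[0, 27/4]` (`exists_measure_moments_fussCatalan`). A `ν` with `K_ν = G_ρ` is the spectral measure,
at a unit vector `ξ`, of multiplication by `x` on `L²(ρ)` enlarged by `ξ` and coupled to it through
the constant function 1 (`exists_measure_of_selfEnergy`). -/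

noncomputable section

open MeasureTheory

namespace CauchyStieltjes

/-! ### Fuss–Catalan numbers and the ternary-tree equation -/

open PowerSeries in
/-- The ternary-tree equation `B = 1 + X * B ^ 3` has a power series solution. -/
theorem exists_powerSeries_eq_one_add_X_mul_cube :
    ∃ B : PowerSeries ℝ, B = 1 + X * B ^ 3 := by
  -- Fixed-point iteration: the factor `X` makes each iterate correct to one more order, so the
  -- coefficients stabilise.
  let b : ℕ → PowerSeries ℝ := fun n => Nat.rec 1 (fun _ f => 1 + X * f ^ 3) n
  have hb (n) : b (n + 1) = 1 + X * b n ^ 3 := rfl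
  have hstep (n) : X ^ (n + 1) ∣ b (n + 1) - b n := by
    induction n with
    | zero => exact ⟨1, by rw [hb]; simp [b]⟩
    | succ n ih =>
      obtain ⟨c, hc⟩ := ih
      refine ⟨c * (b (n + 1) ^ 2 + b (n + 1) * b n + b n ^ 2), ?_⟩
      rw [hb (n + 1), hb n, ← hb n]
      linear_combination X * (b (n + 1) ^ 2 + b (n + 1) * b n + b n ^ 2) * hc
  have hmono (n k) : X ^ (n + 1) ∣ b (n + k) - b n := by
    induction k with
    | zero => simp
    | succ k ih =>
      have h := (pow_dvd_pow (X : PowerSeries ℝ) (by omega : n + 1 ≤ n + k + 1)).trans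
        (hstep (n + k))
      simpa [← add_assoc] using dvd_add h ih
  let B : PowerSeries ℝ := mk fun n => coeff n (b n)
  have hB (n) : X ^ (n + 1) ∣ B - b n := by
    rw [X_pow_dvd_iff]
    intro m hm
    obtain ⟨k, rfl⟩ := Nat.exists_eq_add_of_le (Nat.lt_succ_iff.1 hm)
    have h := X_pow_dvd_iff.1 (hmono m k) m (Nat.lt_succ_self m)
    rw [map_sub] at h ⊢
    simp only [B, coeff_mk]
    linarith
  refine ⟨B, sub_eq_zero.1 (PowerSeries.ext fun n => ?_)⟩
  have h : X ^ (n + 1) ∣ B - (1 + X * B ^ 3) := by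
    have h1 : B - (1 + X * B ^ 3)
        = (B - b (n + 1)) - X * (B ^ 2 + B * b n + b n ^ 2) * (B - b n) := by
      rw [hb]; ring
    rw [h1]
    exact dvd_sub ((pow_dvd_pow _ (by omega)).trans (hB (n + 1))) ((hB n).mul_left _)
  simpa using X_pow_dvd_iff.1 h n (Nat.lt_succ_self n)

/-- The hypergeometric differential equation satisfied by a solution of `B = 1 + X * B ^ 3`. -/
theorem hypergeometric_of_eq_one_add_X_mul_cube {R : Type*} [CommRing R] [IsDomain R]
    {X B p q : R} (hB : B = 1 + X * B ^ 3) (hB0 : B ≠ 0) (hu0 : 1 - 3 * (X * B ^ 2) ≠ 0)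
    (hp : p = X * B ^ 3 + 3 * (X * B ^ 2) * p)
    (hq : q = X * B ^ 3 + 6 * (X * B ^ 2) * p + 6 * (X * B) * p ^ 2 + 3 * (X * B ^ 2) * q) :
    4 * q + 2 * p = X * (27 * q + 27 * p + 6 * B) := by
  set u := 1 - 3 * (X * B ^ 2) with hu
  have hup : u * p = X * B ^ 3 := by rw [hu]; linear_combination hp
  have huq : u ^ 3 * q = X * B ^ 3 * (1 - 3 * (X * B ^ 2) ^ 2) := by
    have h1 : u * q = X * B ^ 3 + 6 * (X * B ^ 2) * p + 6 * (X * B) * p ^ 2 := by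
      rw [hu]; linear_combination hq
    have h2 : u ^ 3 * q = u ^ 2 * (X * B ^ 3) + 6 * (X * B ^ 2) * u * (u * p)
        + 6 * (X * B) * (u * p) ^ 2 := by linear_combination u ^ 2 * h1
    rw [h2, hup, hu]; ring
  -- The factor `u ^ 3` clears the denominators of `p` and `q`; with `B ^ 2`, what remains is a
  -- multiple of `B - 1 - X * B ^ 3`.
  have key : B ^ 2 * u ^ 3 * (4 * q + 2 * p - X * (27 * q + 27 * p + 6 * B)) = 0 := by
    have h2 : B ^ 2 * u ^ 3 * (4 * q + 2 * p - X * (27 * q + 27 * p + 6 * B))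
        = B ^ 2 * ((4 - 27 * X) * (u ^ 3 * q) + (2 - 27 * X) * u ^ 2 * (u * p)
          - 6 * X * B * u ^ 3) := by ring
    rw [h2, hup, huq, hu]
    linear_combination 6 * (X * B ^ 3) * (B - X * B ^ 3 + 1) * hB
  exact sub_eq_zero.1 ((mul_eq_zero.1 key).resolve_left
    (mul_ne_zero (pow_ne_zero _ hB0) (pow_ne_zero _ hu0)))

/-- The Fuss–Catalan numbers `1, 1, 3, 12, 55, …` counting ternary trees. -/
def fussCatalan (n : ℕ) : ℝ := 1 / (3 * (n : ℝ) + 1) * ((3 * n + 1).choose n : ℝ)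

theorem fussCatalan_eq_factorial (n : ℕ) :
    fussCatalan n = (3 * n).factorial / (n.factorial * (2 * n + 1).factorial) := by
  rw [fussCatalan, Nat.cast_choose ℝ (by omega : n ≤ 3 * n + 1),
    show 3 * n + 1 - n = 2 * n + 1 by omega, Nat.factorial_succ (3 * n)]
  push_cast
  have : (3 * (n : ℝ) + 1) ≠ 0 := by positivity
  field_simp

theorem fussCatalan_zero : fussCatalan 0 = 1 := by simp [fussCatalan]

/-- This ratio identifies the numbers twice: as coefficients of `B` and as moments of a beta
product. -/
theorem fussCatalan_succ (n : ℕ) :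
    (2 * (n : ℝ) + 2) * (2 * n + 3) * fussCatalan (n + 1)
      = 3 * (3 * n + 1) * (3 * n + 2) * fussCatalan n := by
  rw [fussCatalan_eq_factorial, fussCatalan_eq_factorial,
    show 3 * (n + 1) = 3 * n + 1 + 1 + 1 by ring, show 2 * (n + 1) + 1 = 2 * n + 1 + 1 + 1 by ring]
  simp only [Nat.factorial_succ]
  push_cast
  field_simp
  ring

theorem fussCatalan_nonneg (n : ℕ) : 0 ≤ fussCatalan n := by unfold fussCatalan; positivity

/-- Successive ratios stay below 7; their limit is 27/4. -/
theorem fussCatalan_le (n : ℕ) : fussCatalan n ≤ 7 ^ n := by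
  induction n with
  | zero => simp [fussCatalan_zero]
  | succ n ih =>
    have h := fussCatalan_succ n
    have h0 := fussCatalan_nonneg n
    have hpos : (0 : ℝ) < (2 * (n : ℝ) + 2) * (2 * n + 3) := by positivity
    have hle : 3 * (3 * (n : ℝ) + 1) * (3 * n + 2) ≤ (2 * (n : ℝ) + 2) * (2 * n + 3) * 7 := by
      have : (0 : ℝ) ≤ n := n.cast_nonneg
      nlinarith
    refine le_of_mul_le_mul_left ?_ hpos
    calc _ = 3 * (3 * (n : ℝ) + 1) * (3 * n + 2) * fussCatalan n := h
      _ ≤ ((2 * (n : ℝ) + 2) * (2 * n + 3) * 7) * fussCatalan n := by gcongr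
      _ ≤ ((2 * (n : ℝ) + 2) * (2 * n + 3) * 7) * 7 ^ n := by gcongr
      _ = _ := by ring

open PowerSeries in
/-- The generating function of the Fuss–Catalan numbers satisfies `B = 1 + X * B ^ 3`. -/
theorem mk_fussCatalan_eq :
    (mk fussCatalan : PowerSeries ℝ) = 1 + X * (mk fussCatalan) ^ 3 := by
  obtain ⟨B, hB⟩ := exists_powerSeries_eq_one_add_X_mul_cube
  suffices h : mk fussCatalan = B by rwa [h]
  let D : PowerSeries ℝ → PowerSeries ℝ := fun f => X * d⁄dX ℝ f
  have hD (f n) : coeff n (D f) = n * coeff n f := by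
    cases n with
    | zero => simp [D]
    | succ n => simp [D, coeff_succ_X_mul, coeff_derivative, mul_comm]
  have hDB : D B = X * B ^ 3 + 3 * (X * B ^ 2) * D B := by
    have h := congrArg D hB
    simp only [D] at h ⊢
    conv_lhs => rw [h]
    simp [Derivation.leibniz, Derivation.leibniz_pow]
    ring
  have hDDB : D (D B) = X * B ^ 3 + 6 * (X * B ^ 2) * D B + 6 * (X * B) * D B ^ 2
      + 3 * (X * B ^ 2) * D (D B) := by
    have h := congrArg D hDB
    have h3 : d⁄dX ℝ (3 : PowerSeries ℝ) = 0 := by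
      simpa using (d⁄dX ℝ : Derivation ℝ _ _).map_natCast 3
    have e1 : D (X * B ^ 3 + 3 * (X * B ^ 2) * D B)
        = X * B ^ 3 + 6 * (X * B ^ 2) * D B + 6 * (X * B) * D B ^ 2
          + 3 * (X * B ^ 2) * D (D B) := by
      generalize hp : D B = p
      have hp' : X * d⁄dX ℝ B = p := hp
      simp [D, Derivation.leibniz, Derivation.leibniz_pow, h3]
      linear_combination (3 * X * B ^ 2 + 6 * X * B * p) * hp'
    exact h.trans e1
  have h0 : coeff 0 B = 1 := by rw [hB]; simp
  -- With `D = X d/dX` acting on the `n`th coefficient as multiplication by `n`, this equation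
  -- becomes the recurrence `fussCatalan_succ`.
  have hode := hypergeometric_of_eq_one_add_X_mul_cube hB
    (fun h => by simp [h] at h0) (fun h => by simpa using congrArg (coeff 0) h) hDB hDDB
  ext n
  rw [coeff_mk]
  induction n with
  | zero => rw [fussCatalan_zero, h0]
  | succ n ih =>
    have h := congrArg (coeff (n + 1)) hode
    have hC (k : ℕ) [k.AtLeastTwo] (f : PowerSeries ℝ) :
        coeff n ((OfNat.ofNat k : PowerSeries ℝ) * f) = (OfNat.ofNat k : ℝ) * coeff n f := by
      rw [← map_ofNat (C (R := ℝ)), coeff_C_mul]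
    have hC' (k : ℕ) [k.AtLeastTwo] (f : PowerSeries ℝ) :
        coeff (n + 1) ((OfNat.ofNat k : PowerSeries ℝ) * f)
          = (OfNat.ofNat k : ℝ) * coeff (n + 1) f := by
      rw [← map_ofNat (C (R := ℝ)), coeff_C_mul]
    rw [coeff_succ_X_mul] at h
    simp only [map_add, hC, hC', hD] at h
    have hs := fussCatalan_succ n
    rw [ih] at hs
    push_cast at h
    have hpos : (0 : ℝ) < (2 * (n : ℝ) + 2) * (2 * n + 3) := by positivity
    refine mul_left_cancel₀ hpos.ne' ?_
    linear_combination hs - h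

/-! ### Spectral measure of a self-adjoint operator at a vector -/

section SpectralMeasure

variable {H : Type*} [NormedAddCommGroup H] [InnerProductSpace ℂ H] [CompleteSpace H]

open scoped CompactlySupported in
/-- The positive functional `f ↦ re ⟪ξ, f(T) ξ⟫` on the continuous functions on the spectrum. -/
def spectralFunctional (T : H →L[ℂ] H) (hT : IsSelfAdjoint T) (ξ : H) :
    C_c(spectrum ℝ T, ℝ) →ₚ[ℝ] ℝ :=
  PositiveLinearMap.mk₀
    { toFun := fun f => (inner ℂ ξ (cfcHom hT (f : C(spectrum ℝ T, ℝ)) ξ)).re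
      map_add' := fun f g => by
        have : ((f + g : C_c(spectrum ℝ T, ℝ)) : C(spectrum ℝ T, ℝ))
          = (f : C(spectrum ℝ T, ℝ)) + (g : C(spectrum ℝ T, ℝ)) := rfl
        rw [this, map_add]
        simp
      map_smul' := fun c f => by
        have : ((c • f : C_c(spectrum ℝ T, ℝ)) : C(spectrum ℝ T, ℝ))
          = c • (f : C(spectrum ℝ T, ℝ)) := rfl
        rw [this, map_smul]
        simp [inner_smul_right_eq_smul] }
    (by
      intro f hf
      -- Positivity: with `f = g²`, the functional equals `‖g(T) ξ‖²`.
      let g : C(spectrum ℝ T, ℝ) := ⟨fun x => √(f x), by fun_prop⟩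
      have hfg : (f : C(spectrum ℝ T, ℝ)) = star g * g := by
        ext x
        exact (Real.mul_self_sqrt (hf x)).symm
      change 0 ≤ (inner ℂ ξ (cfcHom hT (f : C(spectrum ℝ T, ℝ)) ξ)).re
      rw [hfg, map_mul, map_star, ContinuousLinearMap.star_eq_adjoint,
        mul_apply_eq_comp, ContinuousLinearMap.adjoint_inner_right]
      exact inner_self_nonneg (𝕜 := ℂ))

/-- The moments of the spectral measure of a self-adjoint operator at a unit vector. -/
theorem exists_measure_moments_eq_inner (T : H →L[ℂ] H) (hT : IsSelfAdjoint T) (ξ : H)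
    (hξ : ‖ξ‖ = 1) :
    ∃ ν : Measure ℝ, IsProbabilityMeasure ν ∧ IsCompact ν.support ∧
      ∀ n : ℕ, ∫ x, x ^ n ∂ν = (inner ℂ ξ ((T ^ n) ξ)).re := by
  have hK : IsCompact (spectrum ℝ T) := spectrum.isCompact T
  have : CompactSpace (spectrum ℝ T) := isCompact_iff_compactSpace.1 hK
  let μ := RealRMK.rieszMeasure (spectralFunctional T hT ξ)
  have hμ (f : C(spectrum ℝ T, ℝ)) :
      ∫ x, f x ∂μ = (inner ℂ ξ (cfcHom hT f ξ)).re :=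
    RealRMK.integral_rieszMeasure (spectralFunctional T hT ξ)
      ⟨f, HasCompactSupport.of_compactSpace _⟩
  have hmom (n : ℕ) : ∫ x : spectrum ℝ T, (x : ℝ) ^ n ∂μ = (inner ℂ ξ ((T ^ n) ξ)).re := by
    have h := hμ ((ContinuousMap.id ℝ).restrict (spectrum ℝ T) ^ n)
    rw [map_pow, cfcHom_id] at h
    exact h
  have hprob : IsProbabilityMeasure μ := by
    have h := hmom 0
    simp only [pow_zero, integral_const, smul_eq_mul, mul_one, one_apply_eq_self,
      inner_self_eq_norm_sq_to_K, hξ] at h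
    constructor
    have h' : μ.real Set.univ = 1 := by simpa using h
    rwa [measureReal_def, ENNReal.toReal_eq_one_iff] at h'
  have hemb : MeasurableEmbedding ((↑) : spectrum ℝ T → ℝ) :=
    MeasurableEmbedding.subtype_coe hK.isClosed.measurableSet
  refine ⟨μ.map (↑), Measure.isProbabilityMeasure_map hemb.measurable.aemeasurable, ?_, fun n => ?_⟩
  · refine hK.of_isClosed_subset Measure.isClosed_support
      (Measure.support_subset_of_isClosed hK.isClosed ?_)
    rw [mem_ae_iff, hemb.map_apply]
    simp
  · rw [hemb.integral_map, hmom]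

end SpectralMeasure

/-! ### Boolean cumulants from a rank-two perturbation -/

section RankTwoPerturbation

variable {H : Type*} [NormedAddCommGroup H] [InnerProductSpace ℂ H] [CompleteSpace H]

open InnerProductSpace in
/-- A compactly supported probability measure whose boolean cumulants are
`r 1 = 0`, `r (n + 2) = ⟪v, S ^ n v⟫`, in terms of its moments. -/
theorem exists_measure_moments_recurrence (S : H →L[ℂ] H) (hS : IsSelfAdjoint S) (ξ v : H)
    (hξ : ‖ξ‖ = 1) (hSξ : S ξ = 0) (hv : inner ℂ ξ v = 0) (s : ℕ → ℝ)
    (hs : ∀ n, inner ℂ v ((S ^ n) v) = s n) :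
    ∃ ν : Measure ℝ, IsProbabilityMeasure ν ∧ IsCompact ν.support ∧
      ∫ x, x ∂ν = 0 ∧ ∀ n : ℕ, ∫ x, x ^ (n + 2) ∂ν =
        ∑ p ∈ Finset.HasAntidiagonal.antidiagonal n, s p.1 * ∫ x, x ^ p.2 ∂ν := by
  have hT : IsSelfAdjoint (S + rankOne ℂ ξ v + rankOne ℂ v ξ) := by
    rw [ContinuousLinearMap.isSelfAdjoint_iff'] at hS ⊢
    simp only [map_add, hS, adjoint_rankOne]
    abel
  set T := S + rankOne ℂ ξ v + rankOne ℂ v ξ with hTdef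
  obtain ⟨ν, hν, hsupp, hmom⟩ := exists_measure_moments_eq_inner T hT ξ hξ
  -- The range of the self-adjoint `S` is orthogonal to its kernel, which contains `ξ`.
  have hSpow (n : ℕ) : inner ℂ ξ ((S ^ n) v) = 0 := by
    cases n with
    | zero => simpa using hv
    | succ n =>
      rw [pow_succ', mul_apply_eq_comp, ← ContinuousLinearMap.adjoint_inner_left,
        ContinuousLinearMap.isSelfAdjoint_iff'.1 hS, hSξ, inner_zero_left]
  have hTξ : T ξ = v := by
    have hv' : inner ℂ v ξ = 0 := by rw [← inner_conj_symm, hv, map_zero]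
    simp [hTdef, hSξ, hv', inner_self_eq_norm_sq_to_K, hξ]
  have hTS (n : ℕ) : T ((S ^ n) v) = (S ^ (n + 1)) v + (s n : ℂ) • ξ := by
    rw [hTdef, add_apply, add_apply, rankOne_apply,
      rankOne_apply, hSpow, hs, zero_smul, add_zero, pow_succ', mul_apply_eq_comp]
  let a : ℕ → ℂ := fun n => inner ℂ ξ ((T ^ n) ξ)
  -- Decomposition by the last visit to `ξ`: after `p.2` steps, one step to `v`, then `p.1` steps of
  -- `S`.
  have hform (n : ℕ) : (T ^ (n + 1)) ξ = a (n + 1) • ξ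
      + ∑ p ∈ Finset.HasAntidiagonal.antidiagonal n, a p.2 • (S ^ p.1) v := by
    -- The coefficient of `ξ` may stay unspecified: pairing with `ξ` recovers it.
    have hexists : ∃ c : ℂ, (T ^ (n + 1)) ξ = c • ξ
        + ∑ p ∈ Finset.HasAntidiagonal.antidiagonal n, a p.2 • (S ^ p.1) v := by
      induction n with
      | zero => exact ⟨0, by simp [hTξ, a, inner_self_eq_norm_sq_to_K, hξ]⟩
      | succ n ih =>
        obtain ⟨c, hc⟩ := ih
        have hac : a (n + 1) = c := by
          simp only [a, hc, inner_add_right, inner_sum, inner_smul_right, hSpow]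
          simp [inner_self_eq_norm_sq_to_K, hξ]
        refine ⟨∑ p ∈ Finset.HasAntidiagonal.antidiagonal n, a p.2 * s p.1, ?_⟩
        rw [pow_succ', mul_apply_eq_comp, hc, map_add, map_sum,
          Finset.Nat.antidiagonal_succ, Finset.sum_cons, Finset.sum_map]
        simp only [map_smul, hTξ, hTS, smul_add, Finset.sum_add_distrib, Finset.sum_smul,
          smul_smul, ← hac]
        simp
        abel
    obtain ⟨c, hc⟩ := hexists
    have hac : a (n + 1) = c := by
      simp only [a, hc, inner_add_right, inner_sum, inner_smul_right, hSpow]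
      simp [inner_self_eq_norm_sq_to_K, hξ]
    rw [hac, hc]
  have hrec (n : ℕ) : a (n + 2) = ∑ p ∈ Finset.HasAntidiagonal.antidiagonal n, (s p.1 : ℂ) * a p.2 := by
    change inner ℂ ξ ((T ^ (n + 1 + 1)) ξ) = _
    rw [pow_succ', mul_apply_eq_comp, hform, map_add, map_sum]
    simp only [map_smul, hTξ, hTS, inner_add_right, inner_sum, inner_smul_right, hSpow, hv]
    simp [inner_self_eq_norm_sq_to_K, hξ, mul_comm]
  refine ⟨ν, hν, hsupp, ?_, fun n => ?_⟩
  · simpa [hTξ, hv] using hmom 1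
  · simp only [hmom]
    have h := congrArg Complex.re (hrec n)
    simpa [a] using h

end RankTwoPerturbation

/-! ### Realising a given self energy on an `L²` space -/

/-- Multiplication by a bounded measurable real function is a self-adjoint operator on `L²`. -/
theorem exists_isSelfAdjoint_mul {α : Type*} [MeasurableSpace α] (μ : Measure α) [IsFiniteMeasure μ]
    (g : α → ℝ) (hg : Measurable g) (R : ℝ) (hR : ∀ x, |g x| ≤ R) :
    ∃ S : Lp ℂ 2 μ →L[ℂ] Lp ℂ 2 μ, IsSelfAdjoint S ∧
      ∀ f : Lp ℂ 2 μ, S f =ᵐ[μ] fun x => (g x : ℂ) * f x := by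
  have hmem : MemLp (fun x => (g x : ℂ)) ⊤ μ :=
    memLp_top_of_bound (by fun_prop) R (.of_forall fun x => by simpa using hR x)
  let S : Lp ℂ 2 μ →L[ℂ] Lp ℂ 2 μ :=
    (ContinuousLinearMap.mul ℂ ℂ).holderL μ ⊤ 2 2 (hmem.toLp _)
  have hS (f : Lp ℂ 2 μ) : S f =ᵐ[μ] fun x => (g x : ℂ) * f x := by
    filter_upwards [(ContinuousLinearMap.mul ℂ ℂ).coeFn_holder (r := 2) (hmem.toLp _) f,
      hmem.coeFn_toLp] with x hx hx'
    rw [← hx']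
    exact hx
  refine ⟨S, ?_, hS⟩
  rw [ContinuousLinearMap.isSelfAdjoint_iff_isSymmetric]
  intro f h
  change inner ℂ (S f) h = inner ℂ f (S h)
  rw [L2.inner_def, L2.inner_def]
  refine integral_congr_ae ?_
  filter_upwards [hS f, hS h] with x hf hh
  rw [hf, hh]
  simp
  ring

/-- Every probability measure on `[0, R]` is the first-order (boolean) self energy of a compactly
supported probability measure: `r (n + 2) = ∫ x ^ n ∂ρ`. -/
theorem exists_measure_of_selfEnergy (ρ : Measure ℝ) [IsProbabilityMeasure ρ] (R : ℝ)
    (hρ : ∀ᵐ x ∂ρ, x ∈ Set.Icc 0 R) :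
    ∃ ν : Measure ℝ, IsProbabilityMeasure ν ∧ IsCompact ν.support ∧
      ∫ x, x ∂ν = 0 ∧ ∀ n : ℕ, ∫ x, x ^ (n + 2) ∂ν =
        ∑ p ∈ Finset.HasAntidiagonal.antidiagonal n, (∫ x, x ^ p.1 ∂ρ) * ∫ x, x ^ p.2 ∂ν := by
  -- The atom at -1, off `[0, R]`, supplies the extra vector `ξ`. The clamp `g` is bounded, vanishes
  -- at the atom and equals `x` on `[0, R]`; `v` is the indicator of `[0, ∞)`.
  let μ := Measure.dirac (-1 : ℝ) + ρ
  let g : ℝ → ℝ := fun x => max 0 (min x R)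
  have hgR (x : ℝ) : |g x| ≤ max 0 R := by
    rw [abs_of_nonneg (le_max_left _ _)]
    exact max_le_max le_rfl (min_le_right _ _)
  obtain ⟨S, hS, hSg⟩ := exists_isSelfAdjoint_mul μ g (by fun_prop) (max 0 R) hgR
  have hneg : MeasurableSet (Set.Iio (0 : ℝ)) := measurableSet_Iio
  have hnonneg : MeasurableSet (Set.Ici (0 : ℝ)) := measurableSet_Ici
  have hmemξ : MemLp ((Set.Iio (0 : ℝ)).indicator fun _ => (1 : ℂ)) 2 μ :=
    (memLp_const 1).indicator hneg
  have hmemv (n : ℕ) : MemLp ((Set.Ici (0 : ℝ)).indicator fun x => (g x : ℂ) ^ n) 2 μ := by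
    refine MemLp.of_bound ((Measurable.indicator (by fun_prop) hnonneg).aestronglyMeasurable)
      ((max 0 R) ^ n) (.of_forall fun x => ?_)
    refine (norm_indicator_le_norm_self _ _).trans ?_
    rw [norm_pow, Complex.norm_real, Real.norm_eq_abs]
    exact pow_le_pow_left₀ (abs_nonneg _) (hgR x) n
  have hpow (n : ℕ) : (S ^ n) ((hmemv 0).toLp _) = (hmemv n).toLp _ := by
    induction n with
    | zero => simp
    | succ n ih =>
      rw [pow_succ', mul_apply_eq_comp, ih]
      refine Lp.ext ?_
      filter_upwards [hSg ((hmemv n).toLp _), (hmemv n).coeFn_toLp, (hmemv (n + 1)).coeFn_toLp]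
        with x h1 h2 h3
      rw [h1, h2, h3]
      by_cases hx : x ∈ Set.Ici (0 : ℝ) <;> simp [hx, pow_succ']
  have hρneg : ρ (Set.Iio 0) = 0 := by
    refine measure_mono_null ?_ (mem_ae_iff.1 hρ)
    intro x hx hx'
    exact absurd hx'.1 (not_le.2 hx)
  refine exists_measure_moments_recurrence S hS (hmemξ.toLp _) ((hmemv 0).toLp _) ?_ ?_ ?_
    (fun n => ∫ x, x ^ n ∂ρ) fun n => ?_
  · have h : inner ℂ (hmemξ.toLp _) (hmemξ.toLp _) = (1 : ℂ) := by
      rw [L2.inner_def]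
      calc _ = ∫ x, (Set.Iio (0 : ℝ)).indicator (fun _ => (1 : ℂ)) x ∂μ := by
            refine integral_congr_ae ?_
            filter_upwards [hmemξ.coeFn_toLp] with x hx
            rw [hx]
            by_cases h : x < 0 <;> simp [h]
        _ = 1 := by
            rw [integral_indicator hneg]
            simp [μ, hρneg, measureReal_def]
    rw [inner_self_eq_norm_sq_to_K] at h
    have h' : ‖hmemξ.toLp _‖ ^ 2 = 1 := Complex.ofReal_injective (by simpa using h)
    exact (pow_eq_one_iff_of_nonneg (norm_nonneg _) two_ne_zero).1 h'
  · refine Lp.ext ?_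
    filter_upwards [hSg (hmemξ.toLp _), hmemξ.coeFn_toLp, Lp.coeFn_zero ℂ 2 μ] with x h1 h2 h3
    rw [h1, h2, h3]
    by_cases hx : x < 0
    · simp [hx, g, min_le_of_left_le hx.le]
    · simp [hx]
  · rw [L2.inner_def]
    refine integral_eq_zero_of_ae ?_
    filter_upwards [hmemξ.coeFn_toLp, (hmemv 0).coeFn_toLp] with x h1 h2
    rw [h1, h2]
    by_cases hx : x < 0 <;> simp [hx]
  · rw [hpow, L2.inner_def, ← integral_complex_ofReal]
    calc _ = ∫ x, (Set.Ici (0 : ℝ)).indicator (fun x => (g x : ℂ) ^ n) x ∂μ := by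
          refine integral_congr_ae ?_
          filter_upwards [(hmemv 0).coeFn_toLp, (hmemv n).coeFn_toLp] with x h1 h2
          rw [h1, h2]
          by_cases hx : x ∈ Set.Ici (0 : ℝ) <;> simp [hx]
      _ = ∫ x, (Set.Ici (0 : ℝ)).indicator (fun x => (g x : ℂ) ^ n) x ∂ρ := by
          have hint := (hmemv n).integrable (by norm_num)
          rw [integral_add_measure (hint.mono_measure (Measure.le_add_right le_rfl))
            (hint.mono_measure (Measure.le_add_left le_rfl))]
          simp
      _ = _ := by
          refine integral_congr_ae ?_
          filter_upwards [hρ] with x hx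
          simp [hx.1, g, hx.2]

/-! ### Fuss–Catalan numbers as moments of a beta product -/

/-- The moments of the beta distribution. -/
theorem integral_pow_betaMeasure {a b : ℝ} (ha : 0 < a) (hb : 0 < b) (n : ℕ) :
    ∫ x, x ^ n ∂(ProbabilityTheory.betaMeasure a b)
      = ProbabilityTheory.beta (a + n) b / ProbabilityTheory.beta a b := by
  open ProbabilityTheory in
  have han : 0 < a + n := by positivity
  have hnn {c : ℝ} (hc : 0 < c) (x : ℝ) : 0 ≤ betaPDFReal c b x := by
    by_cases hx : 0 < x ∧ x < 1
    · exact (betaPDFReal_pos hx.1 hx.2 hc hb).le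
    · simp [betaPDFReal, hx]
  have hone : ∫ x, betaPDFReal (a + n) b x = 1 := by
    rw [integral_eq_lintegral_of_nonneg_ae (.of_forall (hnn han))
      (measurable_betaPDFReal _ _).aestronglyMeasurable]
    have := lintegral_betaPDF_eq_one han hb
    simp only [betaPDF] at this
    simp [this]
  have hmeas : Measurable (betaPDF a b) := (measurable_betaPDFReal a b).ennreal_ofReal
  rw [betaMeasure, integral_withDensity_eq_integral_toReal_smul hmeas (.of_forall fun x => ENNReal.ofReal_lt_top)]
  -- Multiplying the density by `x ^ n` only shifts `a` to `a + n`, up to normalisation.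
  calc _ = ∫ x, beta (a + n) b / beta a b * betaPDFReal (a + n) b x := by
        congr 1 with x
        rw [betaPDF, ENNReal.toReal_ofReal (hnn ha x), smul_eq_mul]
        by_cases hx : 0 < x ∧ x < 1
        · rw [betaPDFReal, betaPDFReal, if_pos hx, if_pos hx,
            show a + n - 1 = a - 1 + n by ring, Real.rpow_add hx.1, Real.rpow_natCast]
          have := (beta_pos ha hb).ne'
          have := (beta_pos han hb).ne'
          field_simp
        · simp [betaPDFReal, hx]
    _ = _ := by rw [integral_const_mul, hone, mul_one]

theorem integral_pow_succ_betaMeasure {a b : ℝ} (ha : 0 < a) (hb : 0 < b) (n : ℕ) :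
    (a + b + n) * ∫ x, x ^ (n + 1) ∂(ProbabilityTheory.betaMeasure a b)
      = (a + n) * ∫ x, x ^ n ∂(ProbabilityTheory.betaMeasure a b) := by
  have han : 0 < a + n := by positivity
  have habn : 0 < a + b + n := by positivity
  rw [integral_pow_betaMeasure ha hb, integral_pow_betaMeasure ha hb, ProbabilityTheory.beta,
    ProbabilityTheory.beta, ProbabilityTheory.beta, Nat.cast_succ, show a + (n + 1 : ℝ) + b = a + b + n + 1 by ring,
    show a + (n + 1 : ℝ) = a + n + 1 by ring, Real.Gamma_add_one han.ne',
    Real.Gamma_add_one habn.ne', show a + n + b = a + b + n by ring]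
  have := (Real.Gamma_pos_of_pos habn).ne'
  field_simp

theorem ae_mem_Icc_betaMeasure (a b : ℝ) :
    ∀ᵐ x ∂(ProbabilityTheory.betaMeasure a b), x ∈ Set.Icc (0 : ℝ) 1 := by
  have hmeas : Measurable (ProbabilityTheory.betaPDF a b) :=
    (ProbabilityTheory.measurable_betaPDFReal a b).ennreal_ofReal
  rw [ProbabilityTheory.betaMeasure, ae_withDensity_iff hmeas]
  refine .of_forall fun x hx => ⟨?_, ?_⟩
  · by_contra! h
    exact hx (ProbabilityTheory.betaPDF_eq_zero_of_nonpos h.le)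
  · by_contra! h
    exact hx (ProbabilityTheory.betaPDF_eq_zero_of_one_le h.le)

/-- The shifted Fuss–Catalan numbers are the moments of a product of two independent scaled beta
variables. -/
theorem exists_measure_moments_fussCatalan :
    ∃ ρ : Measure ℝ, IsProbabilityMeasure ρ ∧ (∀ᵐ x ∂ρ, x ∈ Set.Icc (0 : ℝ) (27 / 4)) ∧
      ∀ n : ℕ, ∫ x, x ^ n ∂ρ = fussCatalan (n + 1) := by
  -- The ratio of consecutive shifted numbers is `27/4 · (n + 4/3)/(n + 2) · (n + 5/3)/(n + 5/2)`;
  -- beta moments have ratio `(a + n)/(a + b + n)`, which fixes both parameter pairs and the scale.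
  have h1 := ProbabilityTheory.isProbabilityMeasureBeta (α := 4 / 3) (β := 2 / 3)
    (by norm_num) (by norm_num)
  have h2 := ProbabilityTheory.isProbabilityMeasureBeta (α := 5 / 3) (β := 5 / 6)
    (by norm_num) (by norm_num)
  have hm1 := integral_pow_succ_betaMeasure (a := 4 / 3) (b := 2 / 3) (by norm_num) (by norm_num)
  have hm2 := integral_pow_succ_betaMeasure (a := 5 / 3) (b := 5 / 6) (by norm_num) (by norm_num)
  have hs1 := ae_mem_Icc_betaMeasure (4 / 3) (2 / 3)
  have hs2 := ae_mem_Icc_betaMeasure (5 / 3) (5 / 6)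
  set β₁ := ProbabilityTheory.betaMeasure (4 / 3) (2 / 3)
  set β₂ := ProbabilityTheory.betaMeasure (5 / 3) (5 / 6)
  have hmeas : Measurable fun p : ℝ × ℝ => 27 / 4 * (p.1 * p.2) := by fun_prop
  have hmom (n : ℕ) : ∫ x, x ^ n ∂((β₁.prod β₂).map fun p : ℝ × ℝ => 27 / 4 * (p.1 * p.2))
      = (27 / 4) ^ n * ((∫ x, x ^ n ∂β₁) * ∫ x, x ^ n ∂β₂) := by
    rw [integral_map hmeas.aemeasurable (by fun_prop), ← integral_prod_mul, ← integral_const_mul]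
    simp only [mul_pow]
  refine ⟨(β₁.prod β₂).map fun p => 27 / 4 * (p.1 * p.2),
    Measure.isProbabilityMeasure_map hmeas.aemeasurable, ?_, fun n => ?_⟩
  · refine (ae_map_iff hmeas.aemeasurable measurableSet_Icc).2 ?_
    filter_upwards [Measure.quasiMeasurePreserving_fst.ae hs1,
      Measure.quasiMeasurePreserving_snd.ae hs2] with p hp1 hp2
    have h := mul_le_one₀ hp1.2 hp2.1 hp2.2
    exact ⟨by have := mul_nonneg hp1.1 hp2.1; positivity, by linarith⟩
  · rw [hmom]
    induction n with
    | zero => norm_num [fussCatalan]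
    | succ n ih =>
      have hf := fussCatalan_succ (n + 1)
      rw [← ih] at hf
      have e1 := hm1 n
      have e2 := hm2 n
      push_cast at hf
      have hpos : (0 : ℝ) < (2 * ((n : ℝ) + 1) + 2) * (2 * (n + 1) + 3) := by positivity
      refine mul_left_cancel₀ hpos.ne' ?_
      rw [hf]
      set x := ∫ x, x ^ n ∂β₁
      set y := ∫ x, x ^ n ∂β₂
      set x' := ∫ x, x ^ (n + 1) ∂β₁
      set y' := ∫ x, x ^ (n + 1) ∂β₂
      have e3 := congrArg₂ (· * ·) e1 e2
      linear_combination 4 * (27 / 4) ^ (n + 1) * e3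

/-! ### From formal power series to analytic functions near 0 -/

/-- The real power series `f` converges absolutely at `w`, with sum `a`. -/
def HasValue (f : PowerSeries ℝ) (w a : ℂ) : Prop :=
  (Summable fun n => ‖((PowerSeries.coeff n f : ℝ) : ℂ) * w ^ n‖) ∧
    HasSum (fun n => ((PowerSeries.coeff n f : ℝ) : ℂ) * w ^ n) a

namespace HasValue

variable {f g : PowerSeries ℝ} {w a b : ℂ}

theorem unique (hf : HasValue f w a) (hf' : HasValue f w b) : a = b := hf.2.unique hf'.2

theorem one : HasValue 1 w 1 := by
  have h (n : ℕ) (hn : n ∉ ({0} : Finset ℕ)) :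
      ((PowerSeries.coeff n (1 : PowerSeries ℝ) : ℝ) : ℂ) * w ^ n = 0 := by
    simp [PowerSeries.coeff_one, Finset.mem_singleton.not.1 hn]
  refine ⟨summable_of_ne_finset_zero (s := {0}) fun n hn => by rw [h n hn, norm_zero], ?_⟩
  simpa using hasSum_sum_of_ne_finset_zero h

theorem X : HasValue PowerSeries.X w w := by
  have h (n : ℕ) (hn : n ∉ ({1} : Finset ℕ)) :
      ((PowerSeries.coeff n (PowerSeries.X : PowerSeries ℝ) : ℝ) : ℂ) * w ^ n = 0 := by
    simp [PowerSeries.coeff_X, Finset.mem_singleton.not.1 hn]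
  refine ⟨summable_of_ne_finset_zero (s := {1}) fun n hn => by rw [h n hn, norm_zero], ?_⟩
  simpa using hasSum_sum_of_ne_finset_zero h

theorem add (hf : HasValue f w a) (hg : HasValue g w b) : HasValue (f + g) w (a + b) := by
  have h (n : ℕ) : ((PowerSeries.coeff n (f + g) : ℝ) : ℂ) * w ^ n
      = ((PowerSeries.coeff n f : ℝ) : ℂ) * w ^ n + ((PowerSeries.coeff n g : ℝ) : ℂ) * w ^ n := by
    rw [map_add, Complex.ofReal_add, add_mul]
  simp only [HasValue, h]
  refine ⟨?_, hf.2.add hg.2⟩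
  exact (hf.1.add hg.1).of_nonneg_of_le (fun _ => norm_nonneg _) fun _ => norm_add_le _ _

theorem mul (hf : HasValue f w a) (hg : HasValue g w b) : HasValue (f * g) w (a * b) := by
  have h (n : ℕ) : ((PowerSeries.coeff n (f * g) : ℝ) : ℂ) * w ^ n
      = ∑ p ∈ Finset.HasAntidiagonal.antidiagonal n,
        (((PowerSeries.coeff p.1 f : ℝ) : ℂ) * w ^ p.1) * (((PowerSeries.coeff p.2 g : ℝ) : ℂ) * w ^ p.2) := by
    rw [PowerSeries.coeff_mul, Complex.ofReal_sum, Finset.sum_mul]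
    refine Finset.sum_congr rfl fun p hp => ?_
    rw [← Finset.HasAntidiagonal.mem_antidiagonal.1 hp, pow_add]
    push_cast
    ring
  have hs : Summable fun n => ‖((PowerSeries.coeff n (f * g) : ℝ) : ℂ) * w ^ n‖ := by
    have hs := summable_norm_sum_mul_antidiagonal_of_summable_norm hf.1 hg.1
    simp only [← h] at hs
    exact hs
  refine ⟨hs, ?_⟩
  have ht := tsum_mul_tsum_eq_tsum_sum_antidiagonal_of_summable_norm hf.1 hg.1
  rw [hf.2.tsum_eq, hg.2.tsum_eq] at ht
  simp only [← h] at ht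
  exact ht ▸ hs.of_norm.hasSum

end HasValue

/-- The complex Cauchy–Stieltjes kernel transform `w ↦ ∫ 1 / (1 - w x) ν(dx)`. -/
def complexM (ν : Measure ℝ) (w : ℂ) : ℂ := ∫ x, 1 / (1 - w * (x : ℂ)) ∂ν

theorem ofReal_M (ν : Measure ℝ) (θ : ℝ) : ((M ν θ : ℝ) : ℂ) = complexM ν θ := by
  rw [M, complexM, ← integral_complex_ofReal]
  push_cast
  rfl

/-- Geometric expansion of the kernel, integrated termwise by dominated convergence. -/
theorem hasValue_complexM (ν : Measure ℝ) [IsProbabilityMeasure ν] {R : ℝ}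
    (hR : ∀ᵐ x ∂ν, |x| ≤ R) {w : ℂ} (hw : ‖w‖ * R < 1) :
    HasValue (PowerSeries.mk fun n => ∫ x, x ^ n ∂ν) w (complexM ν w) := by
  have hR0 : 0 ≤ R := by
    obtain ⟨x, hx⟩ := hR.exists
    exact (abs_nonneg x).trans hx
  have hwR : 0 ≤ ‖w‖ * R := by positivity
  have hgeom := summable_geometric_of_lt_one hwR hw
  have hbound (n : ℕ) (x : ℝ) (hx : |x| ≤ R) : ‖(w * (x : ℂ)) ^ n‖ ≤ (‖w‖ * R) ^ n := by
    rw [norm_pow, norm_mul, Complex.norm_real, Real.norm_eq_abs]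
    gcongr
  have hsum := hasSum_integral_of_dominated_convergence (μ := ν)
    (F := fun (n : ℕ) (x : ℝ) => (w * (x : ℂ)) ^ n) (f := fun x : ℝ => 1 / (1 - w * (x : ℂ)))
    (fun n _ => (‖w‖ * R) ^ n) (fun n => by fun_prop)
    (fun n => by filter_upwards [hR] with x hx using hbound n x hx)
    (.of_forall fun _ => hgeom) (integrable_const _) (by
      filter_upwards [hR] with x hx
      rw [one_div]
      refine hasSum_geometric_of_norm_lt_one (lt_of_le_of_lt ?_ hw)
      simpa using hbound 1 x hx)
  have hterm (n : ℕ) : ∫ x : ℝ, (w * (x : ℂ)) ^ n ∂ν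
      = ((PowerSeries.coeff n (PowerSeries.mk fun n => ∫ x, x ^ n ∂ν) : ℝ) : ℂ) * w ^ n := by
    simp only [mul_pow, integral_const_mul, PowerSeries.coeff_mk, ← Complex.ofReal_pow,
      integral_complex_ofReal]
    ring
  simp only [hterm] at hsum
  refine ⟨hgeom.of_nonneg_of_le (fun _ => norm_nonneg _) fun n => ?_, hsum⟩
  rw [← hterm]
  refine (norm_integral_le_of_norm_le_const (C := (‖w‖ * R) ^ n) ?_).trans (by simp)
  filter_upwards [hR] with x hx using hbound n x hx

theorem exists_hasValue_fussCatalan {w : ℂ} (hw : ‖w‖ * 7 < 1) :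
    ∃ b : ℂ, HasValue (PowerSeries.mk fussCatalan) w b ∧ b = 1 + w * b ^ 3 := by
  have hs : Summable fun n =>
      ‖((PowerSeries.coeff n (PowerSeries.mk fussCatalan) : ℝ) : ℂ) * w ^ n‖ := by
    refine (summable_geometric_of_lt_one (by positivity) hw).of_nonneg_of_le
      (fun _ => norm_nonneg _) fun n => ?_
    rw [PowerSeries.coeff_mk, norm_mul, Complex.norm_real, norm_pow, Real.norm_eq_abs,
      abs_of_nonneg (fussCatalan_nonneg n), mul_pow, mul_comm]
    gcongr
    exact fussCatalan_le n
  have hb : HasValue (PowerSeries.mk fussCatalan) w _ := ⟨hs, hs.of_norm.hasSum⟩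
  refine ⟨_, hb, hb.unique ?_⟩
  have h := HasValue.one.add (HasValue.X.mul (hb.mul (hb.mul hb)))
  rw [← pow_three, ← pow_three, ← mk_fussCatalan_eq] at h
  exact h

/-- The moment generating function of a measure with boolean cumulants `0, 1, 3, 12, 55, …`. -/
theorem mk_moments_eq (m : ℕ → ℝ) (h0 : m 0 = 1) (h1 : m 1 = 0)
    (h : ∀ n, m (n + 2) = ∑ p ∈ Finset.HasAntidiagonal.antidiagonal n,
      fussCatalan (p.1 + 1) * m p.2) :
    PowerSeries.mk m + PowerSeries.X * PowerSeries.mk m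
      = 1 + PowerSeries.X * (PowerSeries.mk fussCatalan * PowerSeries.mk m) := by
  have hf : PowerSeries.mk fussCatalan
      = 1 + PowerSeries.X * PowerSeries.mk fun n => fussCatalan (n + 1) := by
    ext n
    cases n with
    | zero => simp [fussCatalan_zero]
    | succ n => simp [PowerSeries.coeff_succ_X_mul, PowerSeries.coeff_one]
  have hm : PowerSeries.mk m = 1 + PowerSeries.X * (PowerSeries.X *
      ((PowerSeries.mk fun n => fussCatalan (n + 1)) * PowerSeries.mk m)) := by
    ext n
    match n with
    | 0 => simp [h0]
    | 1 =>
      simp [h1, PowerSeries.coeff_succ_X_mul, PowerSeries.coeff_one,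
        PowerSeries.coeff_zero_X_mul]
    | n + 2 =>
      rw [map_add, PowerSeries.coeff_succ_X_mul, PowerSeries.coeff_succ_X_mul,
        PowerSeries.coeff_mul, PowerSeries.coeff_mk, h]
      simp [PowerSeries.coeff_one]
  rw [hf]
  linear_combination hm

/-! ### The measure and its boolean cumulants -/

/-- A compactly supported probability measure with boolean cumulants `0, 1, 3, 12, 55, …`,
described by its moments. -/
structure IsFussCatalanBoolean (ν : Measure ℝ) : Prop where
  isProbabilityMeasure : IsProbabilityMeasure ν
  isCompact_support : IsCompact ν.support
  mean_eq : ∫ x, x ∂ν = 0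
  moment_eq : ∀ n : ℕ, ∫ x, x ^ (n + 2) ∂ν =
    ∑ p ∈ Finset.HasAntidiagonal.antidiagonal n, fussCatalan (p.1 + 1) * ∫ x, x ^ p.2 ∂ν

theorem exists_isFussCatalanBoolean : ∃ ν : Measure ℝ, IsFussCatalanBoolean ν := by
  obtain ⟨ρ, hρ, hsupp, hmom⟩ := exists_measure_moments_fussCatalan
  obtain ⟨ν, h1, h2, h3, h4⟩ := exists_measure_of_selfEnergy ρ _ hsupp
  exact ⟨ν, h1, h2, h3, by simpa only [hmom] using h4⟩

theorem ae_mem_Icc_edges {ν : Measure ℝ} (hν : IsCompact ν.support) :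
    ∀ᵐ x ∂ν, x ∈ Set.Icc (lowerEdge ν) (upperEdge ν) := by
  filter_upwards [Measure.support_mem_ae (μ := ν)] with x hx
  exact ⟨(min_le_right _ _).trans (csInf_le hν.bddBelow hx),
    (le_csSup hν.bddAbove hx).trans (le_max_right _ _)⟩

theorem exists_ae_abs_le {ν : Measure ℝ} (hν : IsCompact ν.support) :
    ∃ R : ℝ, 0 < R ∧ ∀ᵐ x ∂ν, |x| ≤ R := by
  refine ⟨|lowerEdge ν| + |upperEdge ν| + 1, by positivity, ?_⟩
  filter_upwards [ae_mem_Icc_edges hν] with x hx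
  rw [abs_le]
  constructor <;> linarith [hx.1, hx.2, neg_abs_le (lowerEdge ν), le_abs_self (upperEdge ν),
    abs_nonneg (lowerEdge ν), abs_nonneg (upperEdge ν)]

-- The last identity is `G (z - K) = 1` with `w = 1/z` and `K = b - 1`.
open Filter Topology in
theorem IsFussCatalanBoolean.eventually_complexM {ν : Measure ℝ} (hν : IsFussCatalanBoolean ν) :
    ∀ᶠ w : ℂ in 𝓝 0, ∃ b : ℂ, HasValue (PowerSeries.mk fussCatalan) w b ∧ b = 1 + w * b ^ 3 ∧
      complexM ν w * (1 - w * (b - 1)) = 1 := by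
  have := hν.isProbabilityMeasure
  obtain ⟨R, hR0, hR⟩ := exists_ae_abs_le hν.isCompact_support
  have hlim (c : ℝ) : ∀ᶠ w : ℂ in 𝓝 0, ‖w‖ * c < 1 := by
    have : Tendsto (fun w : ℂ => ‖w‖ * c) (𝓝 0) (𝓝 (‖(0 : ℂ)‖ * c)) := by
      exact Continuous.tendsto (by fun_prop) 0
    exact this.eventually_lt_const (by simp)
  filter_upwards [hlim R, hlim 7] with w hw hw7
  obtain ⟨b, hb, hbw⟩ := exists_hasValue_fussCatalan hw7
  have hM := hasValue_complexM ν hR hw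
  refine ⟨b, hb, hbw, ?_⟩
  have h1 := hM.add (HasValue.X.mul hM)
  rw [mk_moments_eq _ (by simp) (by simpa using hν.mean_eq) hν.moment_eq] at h1
  have h2 := h1.unique (HasValue.one.add (HasValue.X.mul (hb.mul hM)))
  linear_combination h2

open Filter Topology in
theorem IsFussCatalanBoolean.isBooleanCumulantSeq {ν : Measure ℝ} (hν : IsFussCatalanBoolean ν) :
    IsBooleanCumulantSeq ν fun k => if k ≤ 1 then 0 else fussCatalan (k - 1) := by
  refine ⟨by simp, ?_⟩
  have hinv : Tendsto (fun z : ℂ => z⁻¹) (Bornology.cobounded ℂ) (𝓝 0) :=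
    tendsto_inv₀_cobounded
  filter_upwards [hinv.eventually hν.eventually_complexM, Bornology.eventually_ne_cobounded (0 : ℂ)]
    with z ⟨b, hb, _, hM⟩ hz
  have hG : cauchyTransform ν z = z⁻¹ * complexM ν z⁻¹ := by
    rw [cauchyTransform, complexM, ← integral_const_mul]
    congr 1 with x
    rw [one_div, one_div, ← mul_inv, mul_sub, mul_one, mul_inv_cancel_left₀ hz]
  have hM0 : complexM ν z⁻¹ ≠ 0 := fun h => by simp [h] at hM
  have hK : KTransform ν z = b - 1 := by
    rw [KTransform, hG, one_div, mul_inv, inv_inv, inv_eq_of_mul_eq_one_right hM]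
    field_simp [hz]
    ring
  rw [hK]
  have h := hb.2
  -- The zeroth terms differ (`r 1 = 0` against `fussCatalan 0 = 1`), which accounts for the `-1` in
  -- `b - 1`.
  rw [← hasSum_nat_add_iff' 1] at h ⊢
  simpa [fussCatalan_zero, div_eq_mul_inv] using h

/-! ### Analytic continuation to the parameter strip -/

/-- The vertical strip of complex parameters over the parameter interval. -/
def paramStrip (ν : Measure ℝ) : Set ℂ := {w | w.re ∈ paramSet ν}

/-- A lower bound, positive on the strip, of `Re (1 - w x)` for `x` between the two edges. -/
def stripGap (ν : Measure ℝ) (w : ℂ) : ℝ :=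
  min 1 (min (1 - w.re * lowerEdge ν) (1 - w.re * upperEdge ν))

theorem continuous_stripGap (ν : Measure ℝ) : Continuous (stripGap ν) := by
  unfold stripGap
  fun_prop

theorem mem_paramStrip_iff {ν : Measure ℝ} {w : ℂ} : w ∈ paramStrip ν ↔ 0 < stripGap ν w := by
  simp [paramStrip, paramSet, stripGap]

theorem stripGap_le {ν : Measure ℝ} {x : ℝ} (hx : x ∈ Set.Icc (lowerEdge ν) (upperEdge ν))
    (w : ℂ) : stripGap ν w ≤ 1 - w.re * x := by
  unfold stripGap
  rcases le_total 0 w.re with h | h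
  · have := mul_le_mul_of_nonneg_left hx.2 h
    exact (min_le_right _ _).trans ((min_le_right _ _).trans (by linarith))
  · have := mul_le_mul_of_nonpos_left hx.1 h
    exact (min_le_right _ _).trans ((min_le_left _ _).trans (by linarith))

theorem stripGap_le_norm {ν : Measure ℝ} {x : ℝ} (hx : x ∈ Set.Icc (lowerEdge ν) (upperEdge ν))
    (w : ℂ) : stripGap ν w ≤ ‖1 - w * (x : ℂ)‖ := by
  refine (stripGap_le hx w).trans ?_
  simpa using Complex.re_le_norm (1 - w * (x : ℂ))

theorem convex_paramStrip (ν : Measure ℝ) : Convex ℝ (paramStrip ν) := by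
  have h1 : Convex ℝ {w : ℂ | w.re * lowerEdge ν < 1} :=
    convex_halfSpace_lt ⟨fun x y => by simp [add_mul], fun c x => by simp [mul_assoc]⟩ 1
  have h2 : Convex ℝ {w : ℂ | w.re * upperEdge ν < 1} :=
    convex_halfSpace_lt ⟨fun x y => by simp [add_mul], fun c x => by simp [mul_assoc]⟩ 1
  exact h1.inter h2

theorem isOpen_paramStrip (ν : Measure ℝ) : IsOpen (paramStrip ν) := by
  simp only [Set.ext_iff.2 fun w => mem_paramStrip_iff (ν := ν) (w := w)]
  exact isOpen_lt continuous_const (continuous_stripGap ν)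

/-- Differentiation under the integral: where the gap exceeds half its value at `w₀`, the derivative
of the kernel is uniformly bounded. -/
theorem differentiableOn_complexM {ν : Measure ℝ} [IsProbabilityMeasure ν]
    (hν : IsCompact ν.support) : DifferentiableOn ℂ (complexM ν) (paramStrip ν) := by
  intro w₀ hw₀
  obtain ⟨R, hR0, hR⟩ := exists_ae_abs_le hν
  have hc := mem_paramStrip_iff.1 hw₀
  set c := stripGap ν w₀
  have hs : {w | c / 2 < stripGap ν w} ∈ nhds w₀ :=
    (isOpen_lt continuous_const (continuous_stripGap ν)).mem_nhds (half_lt_self hc)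
  have hmeas (w : ℂ) : AEStronglyMeasurable (fun x : ℝ => 1 / (1 - w * (x : ℂ))) ν :=
    (by fun_prop : Measurable fun x : ℝ => 1 / (1 - w * (x : ℂ))).aestronglyMeasurable
  have h := hasDerivAt_integral_of_dominated_loc_of_deriv_le (μ := ν) (𝕜 := ℂ) (E := ℂ)
    (F := fun w x => 1 / (1 - w * (x : ℂ))) (F' := fun w x => x / (1 - w * (x : ℂ)) ^ 2)
    (bound := fun _ => R / (c / 2) ^ 2) hs (.of_forall hmeas) ?_
    (by fun_prop : Measurable fun x : ℝ => (x : ℂ) / (1 - w₀ * (x : ℂ)) ^ 2).aestronglyMeasurable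
    ?_ (integrable_const _) ?_
  · exact h.2.differentiableAt.differentiableWithinAt
  · refine Integrable.of_bound (hmeas w₀) (1 / c) ?_
    filter_upwards [ae_mem_Icc_edges hν] with x hx
    rw [norm_div, norm_one]
    exact one_div_le_one_div_of_le hc (stripGap_le_norm hx w₀)
  · filter_upwards [ae_mem_Icc_edges hν, hR] with x hx hxR w hw
    rw [norm_div, norm_pow, Complex.norm_real, Real.norm_eq_abs]
    have := hw.le.trans (stripGap_le_norm hx w)
    gcongr
  · filter_upwards [ae_mem_Icc_edges hν] with x hx w hw
    have hne : 1 - w * (x : ℂ) ≠ 0 := by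
      rw [← norm_pos_iff]
      exact (half_pos hc).trans (hw.trans_le (stripGap_le_norm hx w))
    have hd : HasDerivAt (fun w : ℂ => 1 - w * (x : ℂ)) (-(x : ℂ)) w := by
      simpa using ((hasDerivAt_id w).mul_const (x : ℂ)).const_sub 1
    simpa [one_div] using! hd.inv hne

theorem zero_mem_paramStrip (ν : Measure ℝ) : (0 : ℂ) ∈ paramStrip ν := by
  simp [paramStrip, paramSet]

/-- The algebraic equation for the Cauchy–Stieltjes transform, by analytic continuation. -/
theorem IsFussCatalanBoolean.complexM_eq {ν : Measure ℝ} (hν : IsFussCatalanBoolean ν) {w : ℂ}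
    (hw : w ∈ paramStrip ν) :
    w * (complexM ν w - 1) * complexM ν w ^ 2
      = (w * complexM ν w + complexM ν w - 1) ^ 3 := by
  have := hν.isProbabilityMeasure
  have hd := differentiableOn_complexM hν.isCompact_support
  have h1 : DifferentiableOn ℂ (fun w => w * (complexM ν w - 1) * complexM ν w ^ 2)
      (paramStrip ν) := by fun_prop
  have h2 : DifferentiableOn ℂ (fun w => (w * complexM ν w + complexM ν w - 1) ^ 3)
      (paramStrip ν) := by fun_prop
  refine (h1.analyticOnNhd (isOpen_paramStrip ν)).eqOn_of_preconnected_of_eventuallyEq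
    (h2.analyticOnNhd (isOpen_paramStrip ν)) (convex_paramStrip ν).isPreconnected
    (zero_mem_paramStrip ν) ?_ hw
  filter_upwards [hν.eventually_complexM] with w ⟨b, _, hb, hM⟩
  set m := complexM ν w
  have e1 : m - 1 = w * m * (b - 1) := by linear_combination hM
  have e2 : w * m + m - 1 = w * m * b := by linear_combination hM
  rw [e1, e2]
  -- Scaling `b = 1 + w b³` by `w² m³` makes `b` occur only through `w m b` and `w m (b - 1)`, both
  -- polynomial in `w` and `m`; no branch of `b` is needed away from 0.
  linear_combination w ^ 2 * m ^ 3 * hb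

/-! ### The variance function -/

variable {ν : Measure ℝ} {θ : ℝ}

theorem IsFussCatalanBoolean.M_eq (hν : IsFussCatalanBoolean ν) (hθ : θ ∈ paramSet ν) :
    θ * (M ν θ - 1) * M ν θ ^ 2 = (θ * M ν θ + M ν θ - 1) ^ 3 := by
  have h := hν.complexM_eq (w := (θ : ℂ)) hθ
  rw [← ofReal_M] at h
  exact_mod_cast h

theorem exists_pos_ae_le_one_sub_mul (hν : IsCompact ν.support) (hθ : θ ∈ paramSet ν) :
    ∃ c > 0, ∀ᵐ x ∂ν, c ≤ 1 - θ * x := by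
  refine ⟨stripGap ν θ, mem_paramStrip_iff.1 hθ, ?_⟩
  filter_upwards [ae_mem_Icc_edges hν] with x hx using stripGap_le hx θ

theorem integrable_pow_of_isCompact_support [IsProbabilityMeasure ν] (hν : IsCompact ν.support)
    (n : ℕ) : Integrable (fun x => x ^ n) ν := by
  obtain ⟨R, hR0, hR⟩ := exists_ae_abs_le hν
  refine Integrable.of_bound (by fun_prop) (R ^ n) ?_
  filter_upwards [hR] with x hx
  rw [norm_pow]
  exact pow_le_pow_left₀ (norm_nonneg _) hx n

theorem integrable_pow_div_one_sub_mul [IsProbabilityMeasure ν] (hν : IsCompact ν.support)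
    (hθ : θ ∈ paramSet ν) (n : ℕ) : Integrable (fun x => x ^ n / (1 - θ * x)) ν := by
  obtain ⟨R, hR0, hR⟩ := exists_ae_abs_le hν
  obtain ⟨c, hc, hcx⟩ := exists_pos_ae_le_one_sub_mul hν hθ
  refine Integrable.of_bound
    (by fun_prop : Measurable fun x : ℝ => x ^ n / (1 - θ * x)).aestronglyMeasurable (R ^ n / c) ?_
  filter_upwards [hR, hcx] with x hx hx'
  rw [norm_div, norm_pow, Real.norm_eq_abs, Real.norm_eq_abs, abs_of_pos (hc.trans_le hx')]
  gcongr

/-- The kernel moments `∫ x ^ n / (1 - θ x) ν(dx)` satisfy a first order recurrence. -/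
theorem mul_integral_pow_succ_div_one_sub_mul [IsProbabilityMeasure ν] (hν : IsCompact ν.support)
    (hθ : θ ∈ paramSet ν) (n : ℕ) :
    θ * ∫ x, x ^ (n + 1) / (1 - θ * x) ∂ν
      = (∫ x, x ^ n / (1 - θ * x) ∂ν) - ∫ x, x ^ n ∂ν := by
  rw [← integral_const_mul, ← integral_sub (integrable_pow_div_one_sub_mul hν hθ n)
    (integrable_pow_of_isCompact_support hν n)]
  obtain ⟨c, hc, hcx⟩ := exists_pos_ae_le_one_sub_mul hν hθ
  refine integral_congr_ae ?_
  filter_upwards [hcx] with x hx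
  have := (hc.trans_le hx).ne'
  field_simp
  ring

theorem M_pos [IsProbabilityMeasure ν] (hν : IsCompact ν.support) (hθ : θ ∈ paramSet ν) :
    0 < M ν θ := by
  obtain ⟨R, hR0, hR⟩ := exists_ae_abs_le hν
  obtain ⟨c, hc, hcx⟩ := exists_pos_ae_le_one_sub_mul hν hθ
  have hK : 0 < 1 + |θ| * R := by positivity
  have h : ∫ _, 1 / (1 + |θ| * R) ∂ν ≤ M ν θ := by
    refine integral_mono_ae (integrable_const _)
      (by simpa using integrable_pow_div_one_sub_mul hν hθ 0) ?_
    filter_upwards [hR, hcx] with x hx hx'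
    refine one_div_le_one_div_of_le (hc.trans_le hx') ?_
    have h1 : |θ * x| ≤ |θ| * R := by rw [abs_mul]; gcongr
    linarith [neg_abs_le (θ * x)]
  refine lt_of_lt_of_le ?_ h
  simpa using hK

theorem integral_P [IsProbabilityMeasure ν] (hν : IsCompact ν.support) (hθ : θ ∈ paramSet ν)
    (f : ℝ → ℝ) : ∫ x, f x ∂(P ν θ) = (∫ x, f x / (1 - θ * x) ∂ν) / M ν θ := by
  have hmeas : Measurable fun x => ENNReal.ofReal (1 / (M ν θ * (1 - θ * x))) := by fun_prop
  obtain ⟨c, hc, hcx⟩ := exists_pos_ae_le_one_sub_mul hν hθ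
  have hM := M_pos hν hθ
  rw [P, integral_withDensity_eq_integral_toReal_smul hmeas
    (.of_forall fun x => ENNReal.ofReal_lt_top), ← integral_div]
  refine integral_congr_ae ?_
  filter_upwards [hcx] with x hx
  have hx' := hc.trans_le hx
  rw [ENNReal.toReal_ofReal (by positivity), smul_eq_mul]
  field_simp

theorem IsFussCatalanBoolean.integral_sq {ν : Measure ℝ} (hν : IsFussCatalanBoolean ν) :
    ∫ x, x ^ 2 ∂ν = 1 := by
  have := hν.isProbabilityMeasure
  have h := hν.moment_eq 0
  have h1 : fussCatalan 1 = 1 := by norm_num [fussCatalan]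
  simpa [h1] using h

theorem IsFussCatalanBoolean.variance_P (hν : IsFussCatalanBoolean ν) (hθ : θ ∈ paramSet ν)
    {m : ℝ} (hm : meanMap ν θ = m) :
    ∫ x, (x - m) ^ 2 ∂(P ν θ) = 1 + 3 * m + 2 * m ^ 2 + m ^ 3 := by
  have := hν.isProbabilityMeasure
  have hc := hν.isCompact_support
  have hM := M_pos hc hθ
  have hI := integrable_pow_div_one_sub_mul hc hθ
  have r0 := mul_integral_pow_succ_div_one_sub_mul hc hθ 0
  have r1 := mul_integral_pow_succ_div_one_sub_mul hc hθ 1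
  have halg := hν.M_eq hθ
  have hM0 : ∫ x, x ^ 0 / (1 - θ * x) ∂ν = M ν θ := by simp [M]
  have hsq : ∫ x, (x - m) ^ 2 / (1 - θ * x) ∂ν = (∫ x, x ^ 2 / (1 - θ * x) ∂ν)
      - 2 * m * (∫ x, x ^ 1 / (1 - θ * x) ∂ν) + m ^ 2 * M ν θ := by
    rw [← hM0, ← integral_const_mul, ← integral_const_mul,
      ← integral_sub (hI 2) ((hI 1).const_mul _),
      ← integral_add (by exact (hI 2).sub ((hI 1).const_mul _)) ((hI 0).const_mul _)]
    congr 1 with x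
    ring
  have hmean : (∫ x, x ^ 1 / (1 - θ * x) ∂ν) = m * M ν θ := by
    rw [← hm, meanMap, integral_P hc hθ]
    simp only [pow_one]
    rw [div_mul_cancel₀ _ hM.ne']
  rw [integral_P hc hθ, hsq]
  rw [hM0, zero_add, hmean] at r0
  rw [hmean] at r1
  simp only [pow_zero, integral_const, probReal_univ, smul_eq_mul, mul_one] at r0
  simp only [pow_one, hν.mean_eq, sub_zero, Nat.reduceAdd] at r1
  rw [hmean]
  -- At `θ = 0` the kernel recurrences lose the higher moment, so the variance is read off from `ν`
  -- itself.
  rcases eq_or_ne θ 0 with rfl | hθ0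
  · have hM1 : M ν 0 = 1 := by linarith
    have hm0 : m = 0 := by simpa [hM1] using r1.symm
    simp [hM1, hm0, hν.integral_sq]
  · set J := ∫ x, x ^ 2 / (1 - θ * x) ∂ν
    set K := M ν θ
    have e1 : K - 1 = θ * (m * K) := r0.symm
    have e2 : θ * K + K - 1 = θ * K * (1 + m) := by linear_combination e1
    rw [e2, e1] at halg
    have e3 : m = θ * (1 + m) ^ 3 := by
      refine mul_left_cancel₀ (by positivity : θ ^ 2 * K ^ 3 ≠ 0) ?_
      linear_combination halg
    have e4 : J = (1 + m) ^ 3 * K := by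
      refine mul_left_cancel₀ hθ0 ?_
      linear_combination r1 + K * e3
    rw [e4]
    field_simp
    ring

end CauchyStieltjes

end

theorem mainTheorem7 :
    ∃ ν : MeasureTheory.Measure ℝ,
      MeasureTheory.IsProbabilityMeasure ν ∧
      IsCompact ν.support ∧
      ∫ x, x ∂ν = 0 ∧
      ProbabilityTheory.variance id ν = 1 ∧
      (∀ m ∈ CauchyStieltjes.meanDomain ν,
        CauchyStieltjes.varianceFunction ν m = 1 + 3 * m + 2 * m ^ 2 + m ^ 3) ∧
      ∃ r : ℕ → ℝ, CauchyStieltjes.IsBooleanCumulantSeq ν r ∧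
        r 1 = 0 ∧
        ∀ n : ℕ, 1 ≤ n →
          r (n + 1) = 1 / (3 * (n : ℝ) + 1) * ((3 * n + 1).choose n : ℝ) := by
  obtain ⟨ν, hν⟩ := CauchyStieltjes.exists_isFussCatalanBoolean
  have := hν.isProbabilityMeasure
  refine ⟨ν, hν.isProbabilityMeasure, hν.isCompact_support, hν.mean_eq, ?_, fun m hm => ?_,
    _, hν.isBooleanCumulantSeq, by simp, fun n hn => ?_⟩
  · rw [ProbabilityTheory.variance_of_integral_eq_zero aemeasurable_id (by simpa using hν.mean_eq)]
    simpa using hν.integral_sq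
  -- The formula holds for every parameter with mean `m`, so injectivity of the mean map is not
  -- needed.
  · exact hν.variance_P (Function.invFunOn_mem hm) (Function.invFunOn_eq hm)
  · rw [if_neg (by omega), Nat.add_sub_cancel, CauchyStieltjes.fussCatalan]
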